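/- A turn sequence is a finite (possibly empty) word $\sigma=\sigma_1\cdots\sigma_n$ with $\sigma_i\in\{\mathtt{L},\mathtt{R}\}$. A rectilinear chain realizes $\sigma$ if it is simple (it has no self-intersection), consists of $n+1$ axis-parallel segments of positive integral lengths, starts at the origin with its first segment heading east, and makes at its successive bends the left ($\mathtt{L}$) and right ($\mathtt{R}$) turns by $90^\circ$ prescribed by $\sigma_1,\dots,\sigma_n$ in this order. Let $A(\sigma)\subseteq\mathbb{Z}^2$ be the set of the endpoints of all chains that realize $\sigma$. Call a set $S\subseteq\mathbb{Z}^2$ connected if it is non-empty and any two points of $S$ can be joined by a path of unit horizontal and vertical steps between lattice points that stays in $S$. Theorem. For every turn sequence $\sigma$, the reachable set $A(\sigma)$ and the unreachable set $\mathbb{Z}^2\setminus A(\sigma)$ are both connected. -/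

import Mathlib

/-- A turn of a rectilinear chain: left (by `+90°`) or right (by `-90°`). -/
inductive Turn where
  | L : Turn
  | R : Turn

/-- The direction of travel after a turn, if `d` is the direction before it. -/
def Turn.apply : Turn → ℤ × ℤ → ℤ × ℤ
  | Turn.L, d => (-d.2, d.1)
  | Turn.R, d => (d.2, -d.1)

/-- The direction of the segment number `i` (counted from `0`) of a chain that starts to the east
and makes the turns of `σ` in order. -/
def heading (σ : List Turn) (i : ℕ) : ℤ × ℤ :=
  (σ.take i).foldl (fun d t => t.apply d) (1, 0)

/-- The vertex number `i` of the chain from the origin with turn sequence `σ` whose segment number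
`j` has length `ℓ j`. The vertex `0` is the origin, the vertices `1, …, σ.length` are the bends, and
the vertex `σ.length + 1` is the endpoint. -/
def chainVertex (σ : List Turn) (ℓ : ℕ → ℕ) (i : ℕ) : ℤ × ℤ :=
  ∑ j ∈ Finset.range i, ℓ j • heading σ j

/-- The lattice points on the segment number `i`, from vertex `i` to vertex `i + 1`. These two
vertices differ in one coordinate only, so the box that they span is the segment. -/
def chainSegment (σ : List Turn) (ℓ : ℕ → ℕ) (i : ℕ) : Set (ℤ × ℤ) :=
  Set.uIcc (chainVertex σ ℓ i) (chainVertex σ ℓ (i + 1))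

/-- The segment lengths `ℓ 0, …, ℓ σ.length` give a simple rectilinear chain that realizes `σ`: they
are positive, and two different segments meet only if they are consecutive, and then only in their
common vertex. (Axis-parallel segments with integral endpoints that meet in the plane have a common
lattice point, and all their common points are lattice points unless they overlap in a segment, so
that it is enough to look at lattice points.) -/
def Realizes (σ : List Turn) (ℓ : ℕ → ℕ) : Prop :=
  (∀ i ≤ σ.length, 0 < ℓ i) ∧
    ∀ i j, i < j → j ≤ σ.length → ∀ q, q ∈ chainSegment σ ℓ i → q ∈ chainSegment σ ℓ j →
      j = i + 1 ∧ q = chainVertex σ ℓ j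

/-- `A(σ)`: the endpoints of the simple rectilinear chains that realize `σ`. -/
def reachableSet (σ : List Turn) : Set (ℤ × ℤ) :=
  {p | ∃ ℓ : ℕ → ℕ, Realizes σ ℓ ∧ chainVertex σ ℓ (σ.length + 1) = p}

/-- The square grid: lattice points are adjacent if they are at distance one. -/
def gridGraph : SimpleGraph (ℤ × ℤ) where
  Adj p q := |p.1 - q.1| + |p.2 - q.2| = 1
  symm := ⟨fun p q h => by rw [abs_sub_comm q.1, abs_sub_comm q.2]; exact h⟩
  loopless := ⟨fun p h => by simp at h⟩

/-- A set of lattice points is connected if it is non-empty and any two of its points are joined by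
a path in the square grid that stays in the set. -/
def GridConnected (S : Set (ℤ × ℤ)) : Prop :=
  (gridGraph.induce S).Connected

/-! Both halves rest on stretching the plane along a cut: all that lies right of the cut moves one
step right. A simple chain stays simple if no vertical segment of it crosses the cut, since a
retraction carries the new segments into the old ones. A straight cut beside the origin pushes
endpoints outward (`chainEnds_expand`). If there is a turn, a cut that jogs across the vertical axis
pushes an endpoint (0, k), k ≠ 0, to (±1, k) (`chainEnds_off_axis`).

Read contrapositively, these moves lead an unreachable point through unreachable points to the
origin, which is never an endpoint.

The reachable set is treated by induction on the number of turns. Let d be the new last direction.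
Doubling a chain makes room for a unit segment, so q ↦ 2q + d sends old endpoints to new ones. Every
new endpoint p is joined to such an image: walk outward to 2p, then shorten the last segment
(`joined_append_unit`). Images of adjacent points are two steps apart, and the point between them is
reachable (`joined_step`), so connectedness is inherited. -/

/-! ### Simple chains as vertex sequences -/

theorem gridGraph_adj_iff {p q : ℤ × ℤ} :
    gridGraph.Adj p q ↔ (p.1 - q.1).natAbs + (p.2 - q.2).natAbs = 1 := by
  simp only [gridGraph, ← Int.natCast_natAbs]
  omega

/-- The unit vectors of the grid. -/
def IsUnitStep (d : ℤ × ℤ) : Prop := d.1.natAbs + d.2.natAbs = 1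

/-- The point `b` lies ahead of `a` in the axis direction `d`. -/
def Ahead (d a b : ℤ × ℤ) : Prop :=
  ((0 < d.1 ↔ a.1 < b.1) ∧ (d.1 < 0 ↔ b.1 < a.1)) ∧
    ((0 < d.2 ↔ a.2 < b.2) ∧ (d.2 < 0 ↔ b.2 < a.2))

/-- The first `n + 1` directions are unit vectors, and consecutive ones are perpendicular. -/
def Headings (h : ℕ → ℤ × ℤ) (n : ℕ) : Prop :=
  (∀ i ≤ n, IsUnitStep (h i)) ∧ ∀ i < n, ((h i).1 = 0 ↔ (h (i + 1)).1 ≠ 0)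

/-- The vertices `v 0 = 0, …, v (n + 1)` form a simple chain with headings `h 0, …, h n`. -/
structure IsSimpleChain (h : ℕ → ℤ × ℤ) (n : ℕ) (v : ℕ → ℤ × ℤ) : Prop where
  zero : v 0 = 0
  ahead : ∀ i ≤ n, Ahead (h i) (v i) (v (i + 1))
  simple : ∀ i j, i < j → j ≤ n → ∀ q, q ∈ Set.uIcc (v i) (v (i + 1)) →
    q ∈ Set.uIcc (v j) (v (j + 1)) → j = i + 1 ∧ q = v j

/-- The endpoints of the simple chains with headings `h 0, …, h n`. -/
def chainEnds (h : ℕ → ℤ × ℤ) (n : ℕ) : Set (ℤ × ℤ) :=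
  {p | ∃ v, IsSimpleChain h n v ∧ v (n + 1) = p}

theorem mem_uIcc_prod {a b q : ℤ × ℤ} :
    q ∈ Set.uIcc a b ↔ (min a.1 b.1 ≤ q.1 ∧ q.1 ≤ max a.1 b.1) ∧
      (min a.2 b.2 ≤ q.2 ∧ q.2 ≤ max a.2 b.2) := by
  simp only [Set.uIcc, Set.mem_Icc, Prod.le_def, Prod.fst_inf, Prod.snd_inf, Prod.fst_sup,
    Prod.snd_sup]
  tauto

theorem Headings.mono {h : ℕ → ℤ × ℤ} {n m : ℕ} (H : Headings h n) (hm : m ≤ n) : Headings h m :=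
  ⟨fun i hi => H.1 i (by omega), fun i hi => H.2 i (by omega)⟩

theorem IsSimpleChain.mono {h : ℕ → ℤ × ℤ} {n m : ℕ} {v : ℕ → ℤ × ℤ} (C : IsSimpleChain h n v) (hm : m ≤ n) :
    IsSimpleChain h m v :=
  ⟨C.zero, fun i hi => C.ahead i (by omega), fun i j hij hj => C.simple i j hij (by omega)⟩

/-- For perpendicular consecutive headings, it suffices that non-consecutive segments are
disjoint. -/
theorem IsSimpleChain.of_disjoint {h : ℕ → ℤ × ℤ} {n : ℕ} {v : ℕ → ℤ × ℤ} (H : Headings h n)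
    (zero : v 0 = 0) (ahead : ∀ i ≤ n, Ahead (h i) (v i) (v (i + 1)))
    (disj : ∀ i j, i + 1 < j → j ≤ n → ∀ q, q ∈ Set.uIcc (v i) (v (i + 1)) →
      q ∉ Set.uIcc (v j) (v (j + 1))) : IsSimpleChain h n v := by
  refine ⟨zero, ahead, fun i j hij hj q hi hq => ?_⟩
  obtain rfl | hlt := (Nat.succ_le_of_lt hij).eq_or_lt
  · refine ⟨rfl, ?_⟩
    have h1 := H.1 i (by omega)
    have h2 := H.1 (i + 1) hj
    have h3 := H.2 i (by omega)
    have a1 := ahead i (by omega)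
    have a2 := ahead (i + 1) hj
    rw [mem_uIcc_prod] at hi hq
    simp only [IsUnitStep, Ahead, Nat.succ_eq_add_one] at *
    ext <;> omega
  · exact absurd hq (disj i j hlt hj q hi)

/-- A vertex sequence whose segments retract into those of a simple chain is simple. -/
theorem IsSimpleChain.of_retract {h : ℕ → ℤ × ℤ} {n : ℕ} {v w : ℕ → ℤ × ℤ} (H : Headings h n)
    (C : IsSimpleChain h n v) (zero : w 0 = 0) (ahead : ∀ i ≤ n, Ahead (h i) (w i) (w (i + 1)))
    (r : ℤ × ℤ → ℤ × ℤ) (hr : ∀ i ≤ n, ∀ q ∈ Set.uIcc (w i) (w (i + 1)),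
      r q ∈ Set.uIcc (v i) (v (i + 1))) : IsSimpleChain h n w := by
  refine .of_disjoint H zero ahead fun i j hij hj q hi hq => ?_
  have := (C.simple i j (by omega) hj _ (hr i (by omega) q hi) (hr j hj q hq)).1
  omega

/-- Doubling all lengths of a chain. -/
theorem IsSimpleChain.double {h : ℕ → ℤ × ℤ} {n : ℕ} {v : ℕ → ℤ × ℤ} (H : Headings h n)
    (C : IsSimpleChain h n v) : IsSimpleChain h n (fun i => (2 * (v i).1, 2 * (v i).2)) := by
  -- Halving with rounding down retracts: doubled segments have even bounds, so rounding stays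
  -- inside the old ones.
  refine .of_retract H C ?_ (fun i hi => ?_) (fun q => (q.1 / 2, q.2 / 2)) fun i hi q hq => ?_
  · simp [C.zero]
  · have := C.ahead i hi
    simp only [Ahead] at *
    omega
  · rw [mem_uIcc_prod] at *
    dsimp only at *
    omega

/-! ### Stretching the plane along a cut -/

/-- Moving the part of the plane with `c y ≤ x` one step to the right. -/
def shiftRight (c : ℤ → ℤ) (q : ℤ × ℤ) : ℤ × ℤ := (if c q.2 ≤ q.1 then q.1 + 1 else q.1, q.2)

/-- The monotone map that undoes `shiftRight`. -/
def unshiftRight (c : ℤ → ℤ) (q : ℤ × ℤ) : ℤ × ℤ := (if c q.2 < q.1 then q.1 - 1 else q.1, q.2)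

/-- By `hc` a vertical segment lies on one side of the cut and moves rigidly. A horizontal one sees
a single value of `c`, where the map is monotone. -/
theorem unshiftRight_mem {h : ℕ → ℤ × ℤ} {n : ℕ} {v : ℕ → ℤ × ℤ} (H : Headings h n)
    (C : IsSimpleChain h n v) (c : ℤ → ℤ)
    (hc : ∀ i ≤ n, (h i).1 = 0 → ∀ q ∈ Set.uIcc (v i) (v (i + 1)),
      (c q.2 ≤ q.1 ↔ c (v i).2 ≤ (v i).1)) {i : ℕ} (hi : i ≤ n) {q : ℤ × ℤ}
    (hq : q ∈ Set.uIcc (shiftRight c (v i)) (shiftRight c (v (i + 1)))) :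
    unshiftRight c q ∈ Set.uIcc (v i) (v (i + 1)) := by
  have h1 := H.1 i hi
  have a1 := C.ahead i hi
  by_cases hv : (h i).1 = 0
  · have c1 := hc i hi hv (v (i + 1)) Set.right_mem_uIcc
    -- `hc` concerns the old segment, so it is tested at the height of `q` but at the old abscissa.
    have c2 := hc i hi hv ((v i).1, q.2)
    rw [mem_uIcc_prod] at *
    simp only [IsUnitStep, Ahead, shiftRight, unshiftRight] at *
    have c3 := c2 (by split_ifs at hq <;> omega)
    have : (v i).1 = (v (i + 1)).1 := by omega
    split_ifs at hq ⊢ <;> omega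
  · have e1 : (v i).2 = (v (i + 1)).2 := by
      simp only [IsUnitStep, Ahead] at *
      omega
    rw [mem_uIcc_prod] at *
    simp only [shiftRight, unshiftRight] at *
    have e2 : q.2 = (v i).2 := by omega
    simp only [← e1, e2] at hq ⊢
    split_ifs at hq ⊢ <;> omega

theorem IsSimpleChain.shiftRight {h : ℕ → ℤ × ℤ} {n : ℕ} {v : ℕ → ℤ × ℤ} (H : Headings h n)
    (C : IsSimpleChain h n v) (c : ℤ → ℤ) (c0 : 0 < c 0)
    (hc : ∀ i ≤ n, (h i).1 = 0 → ∀ q ∈ Set.uIcc (v i) (v (i + 1)),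
      (c q.2 ≤ q.1 ↔ c (v i).2 ≤ (v i).1)) :
    IsSimpleChain h n (fun i => shiftRight c (v i)) := by
  refine .of_retract H C ?_ (fun i hi => ?_) (unshiftRight c)
    fun i hi q hq => unshiftRight_mem H C c hc hi hq
  · simp [C.zero, _root_.shiftRight, c0.not_ge]
  · have h1 := H.1 i hi
    have a1 := C.ahead i hi
    by_cases hv : (h i).1 = 0
    · have c1 := hc i hi hv (v (i + 1)) Set.right_mem_uIcc
      simp only [IsUnitStep, Ahead, _root_.shiftRight] at *
      split_ifs <;> omega
    · have e1 : (v i).2 = (v (i + 1)).2 := by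
        simp only [IsUnitStep, Ahead] at *
        omega
      simp only [IsUnitStep, Ahead, _root_.shiftRight] at *
      rw [← e1] at *
      split_ifs <;> omega

/-! ### Changing the last segment -/

/-- Appending a segment that avoids the chain. -/
theorem IsSimpleChain.append {h : ℕ → ℤ × ℤ} {n : ℕ} {v : ℕ → ℤ × ℤ} (H : Headings h (n + 1))
    (C : IsSimpleChain h n v) (p : ℤ × ℤ) (hp : Ahead (h (n + 1)) (v (n + 1)) p)
    (hd : ∀ q ∈ Set.uIcc (v (n + 1)) p, q ≠ v (n + 1) → ∀ i ≤ n,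
      q ∉ Set.uIcc (v i) (v (i + 1))) : p ∈ chainEnds h (n + 1) := by
  have hu : ∀ i ≤ n + 1, Function.update v (n + 2) p i = v i := fun i hi =>
    Function.update_of_ne (by omega) _ _
  refine ⟨Function.update v (n + 2) p, .of_disjoint H (by rw [hu 0 (by omega), C.zero])
    (fun i hi => ?_) (fun i j hij hj q hi hq => ?_), Function.update_self ..⟩
  · obtain rfl | hlt := hi.eq_or_lt
    · rwa [hu _ le_rfl, Function.update_self]
    · rw [hu i hi, hu (i + 1) (by omega)]
      exact C.ahead i (by omega)
  · rw [hu i (by omega), hu (i + 1) (by omega)] at hi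
    obtain rfl | hlt := hj.eq_or_lt
    · rw [hu _ le_rfl, Function.update_self] at hq
      by_cases hne : q = v (n + 1)
      · have hs := C.simple i n (by omega) le_rfl q hi (hne ▸ Set.right_mem_uIcc)
        have h1 := H.1 n (by omega)
        have a1 := C.ahead n le_rfl
        have e := hne.symm.trans hs.2
        simp only [IsUnitStep, Ahead] at *
        rw [e] at a1
        omega
      · exact hd q hq hne i (by omega) hi
    · rw [hu j hj, hu (j + 1) (by omega)] at hq
      have := (C.simple i j (by omega) (by omega) q hi hq).1
      omega

theorem IsSimpleChain.truncate {h : ℕ → ℤ × ℤ} {n : ℕ} {v : ℕ → ℤ × ℤ} (H : Headings h (n + 1))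
    (C : IsSimpleChain h (n + 1) v) (p : ℤ × ℤ) (hp : Ahead (h (n + 1)) (v (n + 1)) p)
    (hm : p ∈ Set.uIcc (v (n + 1)) (v (n + 2))) : p ∈ chainEnds h (n + 1) := by
  refine (C.mono (Nat.le_succ n)).append H p hp fun q hq hne i hi hqi => ?_
  have := C.simple i (n + 1) (by omega) le_rfl q hqi
    (Set.uIcc_subset_uIcc Set.left_mem_uIcc hm hq)
  exact hne this.2

/-! ### Pushing endpoints outward and off the axes -/

theorem chainEnds_expand {h : ℕ → ℤ × ℤ} {n : ℕ} (H : Headings h n) {x y : ℤ}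
    (hp : (x, y) ∈ chainEnds h n) (hx : 1 ≤ x) : (x + 1, y) ∈ chainEnds h n := by
  obtain ⟨v, C, hv⟩ := hp
  refine ⟨_, C.shiftRight H (fun _ => 1) one_pos fun i hi h0 q hq => ?_, ?_⟩
  · have h1 := H.1 i hi
    have a1 := C.ahead i hi
    rw [mem_uIcc_prod] at hq
    simp only [IsUnitStep, Ahead] at *
    omega
  · simp [hv, shiftRight, hx]

/-- A chain that ends on the positive vertical axis can be pushed off the axis near its end. -/
theorem exists_isSimpleChain_off_axis {h : ℕ → ℤ × ℤ} {n : ℕ} (H : Headings h n) (hn : 1 ≤ n) {k : ℤ}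
    (hk : 0 < k) (hp : (0, k) ∈ chainEnds h n) :
    ∃ v, IsSimpleChain h n v ∧ v (n + 1) = (1, k) ∧
      ((h n).1 = 0 → ∀ i ≤ n, (0, k) ∉ Set.uIcc (v i) (v (i + 1))) := by
  obtain ⟨v, C, hv⟩ := hp
  have z := C.zero
  have z1 : (v 0).1 = 0 := by rw [z]; rfl
  have z2 : (v 0).2 = 0 := by rw [z]; rfl
  have u0 := H.1 0 (by omega)
  have p0 := H.2 0 (by omega)
  have a0 := C.ahead 0 (by omega)
  have un := H.1 n le_rfl
  have an := C.ahead n le_rfl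
  simp only [IsUnitStep, Ahead, zero_add] at u0 p0 a0 un an
  -- The highest point of the first segment on the vertical axis is (0, m); the cut jogs just above
  -- it, which keeps the origin fixed.
  set m : ℤ := max 0 (v 1).2 with hm
  have hmk : m < k := by
    by_contra hlt
    have h0 : ((0, k) : ℤ × ℤ) ∈ Set.uIcc (v 0) (v (0 + 1)) := by
      rw [mem_uIcc_prod]
      simp only [zero_add]
      omega
    have := C.simple 0 n (by omega) le_rfl _ h0 (hv ▸ Set.right_mem_uIcc)
    rw [hv, ← this.2] at an
    dsimp only at an
    omega
  have hc : ∀ i ≤ n, (h i).1 = 0 → ∀ q ∈ Set.uIcc (v i) (v (i + 1)),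
      ((if m < q.2 then (0 : ℤ) else 1) ≤ q.1 ↔ (if m < (v i).2 then (0 : ℤ) else 1) ≤ (v i).1) := by
    intro i hi h0 q hq
    have ui := H.1 i hi
    have ai := C.ahead i hi
    -- The values 0 and 1 of the cut differ only for abscissa 0. A vertical segment there that
    -- crosses the jog contains (0, m), hence meets the first segment; it would have to be the
    -- second one, which is perpendicular to the first.
    have hb : (m < q.2 ↔ m < (v i).2) ∨ (v i).1 ≠ 0 := by
      by_contra! hb
      have h1 : ((0, m) : ℤ × ℤ) ∈ Set.uIcc (v i) (v (i + 1)) := by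
        rw [mem_uIcc_prod] at *
        simp only [IsUnitStep, Ahead] at *
        omega
      have h2 : ((0, m) : ℤ × ℤ) ∈ Set.uIcc (v 0) (v (0 + 1)) := by
        rw [mem_uIcc_prod]
        simp only [zero_add]
        omega
      rcases Nat.eq_zero_or_pos i with rfl | hpos
      · rw [mem_uIcc_prod] at *
        simp only [zero_add] at *
        omega
      · obtain ⟨rfl, e⟩ := C.simple 0 i hpos hi _ h2 h1
        simp only [zero_add] at *
        have e1 := congrArg Prod.fst e
        have e2 := congrArg Prod.snd e
        dsimp only at e1 e2
        omega
    rw [mem_uIcc_prod] at hq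
    simp only [IsUnitStep, Ahead] at *
    split_ifs <;> omega
  refine ⟨_, C.shiftRight H (fun y => if m < y then 0 else 1) (by simp [hm]) hc, ?_, ?_⟩
  · simp [hv, shiftRight, hmk]
  · intro h0 i hi hq
    have hs := unshiftRight_mem H C _ hc hi hq
    have e : unshiftRight (fun y => if m < y then 0 else 1) (0, k) = (0, k) := by
      simp [unshiftRight, hmk]
    rw [e] at hs
    -- Only the last segment of the old chain contains its endpoint; being vertical, it has moved to
    -- abscissa 1 and left (0, k) free.
    have en : i = n := by
      by_contra hne
      have := C.simple i n (by omega) le_rfl _ hs (hv ▸ Set.right_mem_uIcc)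
      rw [hv, ← this.2] at an
      dsimp only at an
      omega
    subst en
    have c1 := hc i le_rfl h0 (v (i + 1)) Set.right_mem_uIcc
    rw [mem_uIcc_prod] at hq
    simp only [shiftRight, hv] at *
    split_ifs at * <;> omega

/-! ### Reflections, and the moves in the other directions -/

/-- The symmetries of the grid that fix the origin and preserve segments. -/
structure IsGridSymmetry (g : ℤ × ℤ → ℤ × ℤ) : Prop where
  invol : ∀ p, g (g p) = p
  zero : g 0 = 0
  ahead : ∀ d a b, Ahead d a b → Ahead (g d) (g a) (g b)
  uIcc : ∀ a b q, q ∈ Set.uIcc (g a) (g b) → g q ∈ Set.uIcc a b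
  unit : ∀ d, IsUnitStep d → IsUnitStep (g d)
  perp : ∀ d e, IsUnitStep d → IsUnitStep e → (d.1 = 0 ↔ e.1 ≠ 0) → ((g d).1 = 0 ↔ (g e).1 ≠ 0)
  adj : ∀ p q, gridGraph.Adj p q → gridGraph.Adj (g p) (g q)

theorem isGridSymmetry_negFst : IsGridSymmetry fun p => (-p.1, p.2) := by
  constructor <;> first
    | (simp; done)
    | (simp only [Ahead, IsUnitStep, mem_uIcc_prod, gridGraph_adj_iff, Prod.forall]
       intros
       omega)

theorem isGridSymmetry_negSnd : IsGridSymmetry fun p => (p.1, -p.2) := by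
  constructor <;> first
    | (simp; done)
    | (simp only [Ahead, IsUnitStep, mem_uIcc_prod, gridGraph_adj_iff, Prod.forall]
       intros
       omega)

theorem isGridSymmetry_swap : IsGridSymmetry Prod.swap := by
  constructor <;>
    simp only [Ahead, IsUnitStep, mem_uIcc_prod, gridGraph_adj_iff, Prod.forall, Prod.swap] <;>
    first | (intros; omega) | simp

theorem IsGridSymmetry.headings {g : ℤ × ℤ → ℤ × ℤ} (hg : IsGridSymmetry g) {h : ℕ → ℤ × ℤ} {n : ℕ}
    (H : Headings h n) : Headings (fun i => g (h i)) n :=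
  ⟨fun i hi => hg.unit _ (H.1 i hi),
    fun i hi => hg.perp _ _ (H.1 i hi.le) (H.1 (i + 1) hi) (H.2 i hi)⟩

theorem IsGridSymmetry.mem_chainEnds {g : ℤ × ℤ → ℤ × ℤ} (hg : IsGridSymmetry g) {h : ℕ → ℤ × ℤ}
    {n : ℕ} {p : ℤ × ℤ} (hp : p ∈ chainEnds h n) : g p ∈ chainEnds (fun i => g (h i)) n := by
  obtain ⟨v, C, rfl⟩ := hp
  refine ⟨fun i => g (v i), ⟨by simp only [C.zero, hg.zero], fun i hi => hg.ahead _ _ _ (C.ahead i hi),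
    fun i j hij hj q hi hq => ?_⟩, rfl⟩
  have := C.simple i j hij hj (g q) (hg.uIcc _ _ _ hi) (hg.uIcc _ _ _ hq)
  exact ⟨this.1, by rw [← this.2, hg.invol]⟩

theorem IsGridSymmetry.mem_chainEnds_of_map {g : ℤ × ℤ → ℤ × ℤ} (hg : IsGridSymmetry g)
    {h : ℕ → ℤ × ℤ} {n : ℕ} {p : ℤ × ℤ} (hp : g p ∈ chainEnds (fun i => g (h i)) n) :
    p ∈ chainEnds h n := by
  have := hg.mem_chainEnds hp
  simpa only [hg.invol] using this

theorem chainEnds_expand_left {h : ℕ → ℤ × ℤ} {n : ℕ} (H : Headings h n) {x y : ℤ}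
    (hp : (x, y) ∈ chainEnds h n) (hx : x ≤ -1) : (x - 1, y) ∈ chainEnds h n := by
  refine isGridSymmetry_negFst.mem_chainEnds_of_map ?_
  have := chainEnds_expand (isGridSymmetry_negFst.headings H)
    (isGridSymmetry_negFst.mem_chainEnds hp) (by dsimp only; omega)
  convert this using 2
  dsimp only
  omega

theorem chainEnds_expand_up {h : ℕ → ℤ × ℤ} {n : ℕ} (H : Headings h n) {x y : ℤ}
    (hp : (x, y) ∈ chainEnds h n) (hy : 1 ≤ y) : (x, y + 1) ∈ chainEnds h n :=
  isGridSymmetry_swap.mem_chainEnds_of_map <| chainEnds_expand (isGridSymmetry_swap.headings H)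
    (isGridSymmetry_swap.mem_chainEnds hp) hy

theorem chainEnds_expand_down {h : ℕ → ℤ × ℤ} {n : ℕ} (H : Headings h n) {x y : ℤ}
    (hp : (x, y) ∈ chainEnds h n) (hy : y ≤ -1) : (x, y - 1) ∈ chainEnds h n :=
  isGridSymmetry_swap.mem_chainEnds_of_map <| chainEnds_expand_left (isGridSymmetry_swap.headings H)
    (isGridSymmetry_swap.mem_chainEnds hp) hy

theorem chainEnds_off_axis {h : ℕ → ℤ × ℤ} {n : ℕ} (H : Headings h n) (hn : 1 ≤ n) {k : ℤ}
    (hk : k ≠ 0) (hp : (0, k) ∈ chainEnds h n) : (1, k) ∈ chainEnds h n := by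
  rcases hk.lt_or_gt with hk | hk
  · obtain ⟨v, C, e, -⟩ := exists_isSimpleChain_off_axis (isGridSymmetry_negSnd.headings H) hn
      (neg_pos.2 hk) (isGridSymmetry_negSnd.mem_chainEnds hp)
    exact isGridSymmetry_negSnd.mem_chainEnds_of_map ⟨v, C, e⟩
  · obtain ⟨v, C, e, -⟩ := exists_isSimpleChain_off_axis H hn hk hp
    exact ⟨v, C, e⟩

theorem chainEnds_off_axis_left {h : ℕ → ℤ × ℤ} {n : ℕ} (H : Headings h n) (hn : 1 ≤ n) {k : ℤ}
    (hk : k ≠ 0) (hp : (0, k) ∈ chainEnds h n) : (-1, k) ∈ chainEnds h n :=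
  isGridSymmetry_negFst.mem_chainEnds_of_map <| chainEnds_off_axis
    (isGridSymmetry_negFst.headings H) hn hk (isGridSymmetry_negFst.mem_chainEnds hp)

/-- Push the end to (1, k), which leaves (0, k) free, and double: then the segment of length two
from (2, 2k) back to the axis avoids the chain. -/
theorem chainEnds_double_axis_of_pos {h : ℕ → ℤ × ℤ} {n : ℕ} (H : Headings h (n + 1)) (hn : 1 ≤ n)
    {k : ℤ} (hk : 0 < k) (hp : (0, k) ∈ chainEnds h n) (hd : (h (n + 1)).1 = -1) :
    (0, 2 * k) ∈ chainEnds h (n + 1) := by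
  obtain ⟨v, C, e, hv⟩ := exists_isSimpleChain_off_axis (H.mono (Nat.le_succ n)) hn hk hp
  have hu := H.1 (n + 1) le_rfl
  have hv := hv (by have := H.2 n (by omega); omega)
  refine (C.double (H.mono (Nat.le_succ n))).append H (0, 2 * k) ?_ ?_
  · simp only [IsUnitStep, Ahead, e] at *
    omega
  · intro q hq hne i hi hqi
    have ui := H.1 i (by omega)
    have ai := C.ahead i hi
    have hv1 := hv i hi
    have hv2 : v (n + 1) ∈ Set.uIcc (v i) (v (i + 1)) → (h i).1 = 0 := by
      intro hm
      obtain rfl | hlt := hi.eq_or_lt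
      · have := H.2 i (by omega)
        omega
      · have hs := C.simple i n hlt le_rfl _ hm Set.right_mem_uIcc
        have an := C.ahead n le_rfl
        have un := H.1 n (by omega)
        rw [hs.2] at an
        simp only [IsUnitStep, Ahead] at *
        omega
    rw [e] at hv2
    rw [mem_uIcc_prod] at *
    simp only [IsUnitStep, Ahead, e] at *
    have : q.1 ≠ 2 ∨ q.2 ≠ 2 * k := by
      by_contra! hh
      exact hne (Prod.ext hh.1 hh.2)
    omega

theorem chainEnds_double_axis {h : ℕ → ℤ × ℤ} {n : ℕ} (H : Headings h (n + 1)) (hn : 1 ≤ n)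
    {k : ℤ} (hk : k ≠ 0) (hp : (0, k) ∈ chainEnds h n) (hd : (h (n + 1)).1 = -1) :
    (0, 2 * k) ∈ chainEnds h (n + 1) := by
  rcases hk.lt_or_gt with hk | hk
  · refine isGridSymmetry_negSnd.mem_chainEnds_of_map ?_
    have := chainEnds_double_axis_of_pos (isGridSymmetry_negSnd.headings H) hn
      (neg_pos.2 hk) (isGridSymmetry_negSnd.mem_chainEnds hp) hd
    simpa using this
  · exact chainEnds_double_axis_of_pos H hn hk hp hd

/-- Doubling a chain makes room for one more unit segment. -/
theorem chainEnds_append_unit {h : ℕ → ℤ × ℤ} {n : ℕ} (H : Headings h (n + 1)) {q : ℤ × ℤ}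
    (hq : q ∈ chainEnds h n) :
    (2 * q.1 + (h (n + 1)).1, 2 * q.2 + (h (n + 1)).2) ∈ chainEnds h (n + 1) := by
  obtain ⟨v, C, rfl⟩ := hq
  have hu := H.1 (n + 1) le_rfl
  refine (C.double (H.mono (Nat.le_succ n))).append H _ ?_ ?_
  · simp only [IsUnitStep, Ahead] at *
    omega
  · intro q hq hne i hi hqi
    have ui := H.1 i (by omega)
    have ai := C.ahead i hi
    -- The appended point has one odd coordinate, so a doubled segment through it is parallel to the
    -- new one and comes from a segment through `v (n + 1)`; this excludes it.
    have hv2 : v (n + 1) ∈ Set.uIcc (v i) (v (i + 1)) → ((h i).1 = 0 ↔ (h (n + 1)).1 ≠ 0) := by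
      intro hm
      obtain rfl | hlt := hi.eq_or_lt
      · exact H.2 i (by omega)
      · have hs := C.simple i n hlt le_rfl _ hm Set.right_mem_uIcc
        have an := C.ahead n le_rfl
        have un := H.1 n (by omega)
        rw [hs.2] at an
        simp only [IsUnitStep, Ahead] at *
        omega
    rw [mem_uIcc_prod] at *
    simp only [IsUnitStep, Ahead] at *
    have : q.1 ≠ 2 * (v (n + 1)).1 ∨ q.2 ≠ 2 * (v (n + 1)).2 := by
      by_contra! hh
      exact hne (Prod.ext hh.1 hh.2)
    omega

theorem chainEnds_zero {h : ℕ → ℤ × ℤ} (H : Headings h 0) : h 0 ∈ chainEnds h 0 := by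
  refine ⟨fun i => if i = 0 then 0 else h 0, .of_disjoint H (by simp) (fun i hi => ?_)
    fun i j hij hj => by omega, by simp⟩
  obtain rfl : i = 0 := by omega
  simp [Ahead]

theorem chainEnds_nonempty {h : ℕ → ℤ × ℤ} {n : ℕ} (H : Headings h n) :
    (chainEnds h n).Nonempty := by
  induction n with
  | zero => exact ⟨_, chainEnds_zero H⟩
  | succ n ih =>
    obtain ⟨q, hq⟩ := ih (H.mono (Nat.le_succ n))
    exact ⟨_, chainEnds_append_unit H hq⟩

theorem zero_notMem_chainEnds {h : ℕ → ℤ × ℤ} {n : ℕ} (H : Headings h n) :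
    (0 : ℤ × ℤ) ∉ chainEnds h n := by
  rintro ⟨v, C, e⟩
  have un := H.1 n le_rfl
  have an := C.ahead n le_rfl
  have z := C.zero
  rcases Nat.eq_zero_or_pos n with rfl | hn
  · rw [e, z] at an
    simp only [IsUnitStep, Ahead] at *
    omega
  · have hs := C.simple 0 n hn le_rfl 0 (z ▸ Set.left_mem_uIcc) (e ▸ Set.right_mem_uIcc)
    rw [e, hs.2] at an
    simp only [IsUnitStep, Ahead] at *
    omega

/-! ### Grid paths -/

/-- Two points are joined by a grid path in `S`. -/
def GridJoined (S : Set (ℤ × ℤ)) : ℤ × ℤ → ℤ × ℤ → Prop :=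
  Relation.ReflTransGen fun a b => a ∈ S ∧ b ∈ S ∧ gridGraph.Adj a b

theorem GridJoined.symm {S : Set (ℤ × ℤ)} {a b : ℤ × ℤ} (hab : GridJoined S a b) :
    GridJoined S b a := by
  induction hab with
  | refl => exact .refl
  | tail _ hs ih => exact .head ⟨hs.2.1, hs.1, hs.2.2.symm⟩ ih

theorem GridJoined.trans {S : Set (ℤ × ℤ)} {a b c : ℤ × ℤ} (hab : GridJoined S a b)
    (hbc : GridJoined S b c) : GridJoined S a c :=
  Relation.ReflTransGen.trans hab hbc

theorem GridJoined.of_adj {S : Set (ℤ × ℤ)} {a b : ℤ × ℤ} (ha : a ∈ S) (hb : b ∈ S)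
    (hab : gridGraph.Adj a b) : GridJoined S a b :=
  .single ⟨ha, hb, hab⟩

theorem gridConnected_of_joined {S : Set (ℤ × ℤ)} {o : ℤ × ℤ} (ho : o ∈ S)
    (hS : ∀ p ∈ S, GridJoined S p o) : GridConnected S := by
  have key : ∀ p (hp : p ∈ S), (gridGraph.induce S).Reachable ⟨p, hp⟩ ⟨o, ho⟩ := by
    intro p hp
    have hj := hS p hp
    induction hj using Relation.ReflTransGen.head_induction_on with
    | refl => exact .refl _
    | head hs hr ih =>
      exact (SimpleGraph.Adj.reachable (G := gridGraph.induce S) (u := ⟨_, hp⟩) (v := ⟨_, hs.2.1⟩)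
        hs.2.2).trans (ih hs.2.1)
  have : Nonempty S := ⟨⟨o, ho⟩⟩
  exact ⟨fun a b => (key a.1 a.2).trans (key b.1 b.2).symm⟩

theorem GridConnected.joined {S : Set (ℤ × ℤ)} (hS : GridConnected S) {a b : ℤ × ℤ} (ha : a ∈ S)
    (hb : b ∈ S) : GridJoined S a b := by
  have hr := (SimpleGraph.reachable_iff_reflTransGen _ _).1 (hS.preconnected ⟨a, ha⟩ ⟨b, hb⟩)
  exact hr.lift (fun x : S => (x : ℤ × ℤ)) fun x y h => ⟨x.2, y.2, h⟩

theorem IsGridSymmetry.joined_of_map {g : ℤ × ℤ → ℤ × ℤ} (hg : IsGridSymmetry g) {h : ℕ → ℤ × ℤ}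
    {n : ℕ} {a b : ℤ × ℤ} (hab : GridJoined (chainEnds (fun i => g (h i)) n) (g a) (g b)) :
    GridJoined (chainEnds h n) a b := by
  have := hab.lift (p := fun a b => a ∈ chainEnds h n ∧ b ∈ chainEnds h n ∧
    gridGraph.Adj a b) g (fun x y hxy => ⟨hg.mem_chainEnds_of_map (by rw [hg.invol]; exact hxy.1),
      hg.mem_chainEnds_of_map (by rw [hg.invol]; exact hxy.2.1), hg.adj _ _ hxy.2.2⟩)
  rwa [Function.onFun, hg.invol, hg.invol] at this

/-! ### Connectedness of the reachable set -/

theorem joined_expand {h : ℕ → ℤ × ℤ} {n : ℕ} (H : Headings h n) {x y : ℤ}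
    (hp : (x, y) ∈ chainEnds h n) (hx : 1 ≤ x) (k : ℕ) :
    (x + k, y) ∈ chainEnds h n ∧ GridJoined (chainEnds h n) (x, y) (x + k, y) := by
  induction k with
  | zero => simpa using ⟨hp, .refl⟩
  | succ k ih =>
    have := chainEnds_expand H ih.1 (by omega)
    rw [show x + ((k + 1 : ℕ) : ℤ) = x + k + 1 by push_cast; ring]
    exact ⟨this, ih.2.trans (.of_adj ih.1 this (by simp [gridGraph_adj_iff]))⟩

theorem joined_double_fst {h : ℕ → ℤ × ℤ} {n : ℕ} (H : Headings h n) {x y : ℤ}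
    (hp : (x, y) ∈ chainEnds h n) :
    (2 * x, y) ∈ chainEnds h n ∧ GridJoined (chainEnds h n) (x, y) (2 * x, y) := by
  rcases lt_trichotomy x 0 with hx | rfl | hx
  · have := joined_expand (isGridSymmetry_negFst.headings H)
      (isGridSymmetry_negFst.mem_chainEnds hp) (by dsimp only; omega) (-x).toNat
    have e : -x + ((-x).toNat : ℤ) = -(2 * x) := by omega
    dsimp only at this
    rw [e] at this
    exact ⟨isGridSymmetry_negFst.mem_chainEnds_of_map this.1,
      isGridSymmetry_negFst.joined_of_map this.2⟩
  · simpa using ⟨hp, .refl⟩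
  · have := joined_expand H hp (by omega) x.toNat
    have e : x + (x.toNat : ℤ) = 2 * x := by omega
    rwa [e] at this

theorem joined_double {h : ℕ → ℤ × ℤ} {n : ℕ} (H : Headings h n) {x y : ℤ}
    (hp : (x, y) ∈ chainEnds h n) : GridJoined (chainEnds h n) (x, y) (2 * x, 2 * y) := by
  obtain ⟨h1, h2⟩ := joined_double_fst H hp
  exact h2.trans (isGridSymmetry_swap.joined_of_map (joined_double_fst
    (isGridSymmetry_swap.headings H) (isGridSymmetry_swap.mem_chainEnds h1)).2)

/-- Points of a segment that lie ahead of its start are joined to the first one of them. -/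
theorem joined_truncate {h : ℕ → ℤ × ℤ} {n : ℕ} {v : ℕ → ℤ × ℤ} (H : Headings h (n + 1))
    (C : IsSimpleChain h (n + 1) v) (k : ℕ) :
    ∀ p ∈ Set.uIcc (v (n + 1)) (v (n + 2)), Ahead (h (n + 1)) (v (n + 1)) p →
      (p.1 - (v (n + 1)).1).natAbs + (p.2 - (v (n + 1)).2).natAbs = k + 1 →
      GridJoined (chainEnds h (n + 1)) p
        ((v (n + 1)).1 + (h (n + 1)).1, (v (n + 1)).2 + (h (n + 1)).2) := by
  have hu := H.1 (n + 1) le_rfl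
  induction k with
  | zero =>
    intro p hp ha hk
    have : p = ((v (n + 1)).1 + (h (n + 1)).1, (v (n + 1)).2 + (h (n + 1)).2) := by
      simp only [IsUnitStep, Ahead] at *
      ext <;> dsimp only <;> omega
    rw [← this]
    exact .refl
  | succ k ih =>
    intro p hp ha hk
    have hp' : (p.1 - (h (n + 1)).1, p.2 - (h (n + 1)).2) ∈ Set.uIcc (v (n + 1)) (v (n + 2)) := by
      rw [mem_uIcc_prod] at *
      simp only [IsUnitStep, Ahead] at *
      omega
    have ha' : Ahead (h (n + 1)) (v (n + 1)) (p.1 - (h (n + 1)).1, p.2 - (h (n + 1)).2) := by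
      simp only [IsUnitStep, Ahead] at *
      omega
    refine GridJoined.trans (.of_adj (C.truncate H p ha hp) (C.truncate H _ ha' hp') ?_)
      (ih _ hp' ha' ?_)
    · simp only [gridGraph_adj_iff, IsUnitStep] at *
      omega
    · simp only [IsUnitStep, Ahead] at *
      omega

theorem joined_append_unit {h : ℕ → ℤ × ℤ} {n : ℕ} (H : Headings h (n + 1)) {p : ℤ × ℤ}
    (hp : p ∈ chainEnds h (n + 1)) :
    ∃ q ∈ chainEnds h n, GridJoined (chainEnds h (n + 1)) p
      (2 * q.1 + (h (n + 1)).1, 2 * q.2 + (h (n + 1)).2) := by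
  have hj := joined_double H hp
  obtain ⟨v, C, rfl⟩ := hp
  refine ⟨v (n + 1), ⟨v, C.mono (Nat.le_succ n), rfl⟩, hj.trans ?_⟩
  have D := C.double H
  have a := D.ahead (n + 1) le_rfl
  have hu := H.1 (n + 1) le_rfl
  refine joined_truncate H D
    ((2 * (v (n + 2)).1 - 2 * (v (n + 1)).1).natAbs +
      (2 * (v (n + 2)).2 - 2 * (v (n + 1)).2).natAbs - 1) _ Set.right_mem_uIcc a ?_
  simp only [IsUnitStep, Ahead, add_assoc, Nat.reduceAdd] at *
  omega

/-- The two points are two steps apart. The point between them is reached by expansion, except when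
`x = 0` and the last direction is vertical (push off the axis) or west (`chainEnds_double_axis`). -/
theorem joined_step_right {h : ℕ → ℤ × ℤ} {n : ℕ} (H : Headings h (n + 1)) {x y : ℤ} (hx : 0 ≤ x)
    (hp : (x, y) ∈ chainEnds h n) (hq : (x + 1, y) ∈ chainEnds h n) :
    GridJoined (chainEnds h (n + 1)) (2 * x + (h (n + 1)).1, 2 * y + (h (n + 1)).2)
      (2 * (x + 1) + (h (n + 1)).1, 2 * y + (h (n + 1)).2) := by
  have hu := H.1 (n + 1) le_rfl
  have hP := chainEnds_append_unit H hp
  have hQ := chainEnds_append_unit H hq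
  dsimp only at hP hQ
  have he : 2 * (x + 1) + (h (n + 1)).1 = 2 * x + (h (n + 1)).1 + 1 + 1 := by ring
  rw [he] at hQ ⊢
  suffices hM : (2 * x + (h (n + 1)).1 + 1, 2 * y + (h (n + 1)).2) ∈ chainEnds h (n + 1) from
    (GridJoined.of_adj hP hM (by simp [gridGraph_adj_iff])).trans (.of_adj hM hQ (by simp [gridGraph_adj_iff]))
  by_cases hpos : 1 ≤ 2 * x + (h (n + 1)).1
  · exact chainEnds_expand H hP hpos
  simp only [IsUnitStep] at hu
  obtain rfl : x = 0 := by omega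
  by_cases h0 : (h (n + 1)).1 = 0
  · simp only [h0, mul_zero, add_zero, zero_add] at hP ⊢
    exact chainEnds_off_axis H (by omega) (by omega) hP
  · have h1 : (h (n + 1)).1 = -1 := by omega
    have h2 : (h (n + 1)).2 = 0 := by omega
    simp only [h1, h2, mul_zero, add_zero, zero_add, neg_add_cancel]
    refine chainEnds_double_axis H ?_ ?_ hp h1
    -- A single segment cannot end at both (0, y) and (1, y): it would have y = 0 in one case and y
    -- ≠ 0 in the other.
    · by_contra hn
      obtain rfl : n = 0 := by omega
      obtain ⟨v, C, e⟩ := hp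
      obtain ⟨w, D, e'⟩ := hq
      have a := C.ahead 0 le_rfl
      have b := D.ahead 0 le_rfl
      have u := H.1 0 (by omega)
      rw [e, C.zero] at a
      rw [e', D.zero] at b
      simp only [IsUnitStep, Ahead, Prod.fst_zero, Prod.snd_zero] at *
      omega
    · rintro rfl
      exact zero_notMem_chainEnds (H.mono (Nat.le_succ n)) hp

theorem joined_step_horizontal {h : ℕ → ℤ × ℤ} {n : ℕ} (H : Headings h (n + 1)) {x y : ℤ}
    (hp : (x, y) ∈ chainEnds h n) (hq : (x + 1, y) ∈ chainEnds h n) :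
    GridJoined (chainEnds h (n + 1)) (2 * x + (h (n + 1)).1, 2 * y + (h (n + 1)).2)
      (2 * (x + 1) + (h (n + 1)).1, 2 * y + (h (n + 1)).2) := by
  rcases le_or_gt 0 x with hx | hx
  · exact joined_step_right H hx hp hq
  · refine (isGridSymmetry_negFst.joined_of_map ?_).symm
    have e : -(x + 1) + 1 = -x := by ring
    have := joined_step_right (x := -(x + 1)) (y := y) (isGridSymmetry_negFst.headings H) (by omega)
      (isGridSymmetry_negFst.mem_chainEnds hq)
      (by rw [e]; exact isGridSymmetry_negFst.mem_chainEnds hp)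
    rw [e] at this
    convert this using 2 <;> dsimp only <;> ring

theorem joined_step {h : ℕ → ℤ × ℤ} {n : ℕ} (H : Headings h (n + 1)) {p q : ℤ × ℤ}
    (hp : p ∈ chainEnds h n) (hq : q ∈ chainEnds h n) (hpq : gridGraph.Adj p q) :
    GridJoined (chainEnds h (n + 1)) (2 * p.1 + (h (n + 1)).1, 2 * p.2 + (h (n + 1)).2)
      (2 * q.1 + (h (n + 1)).1, 2 * q.2 + (h (n + 1)).2) := by
  obtain ⟨x, y⟩ := p
  obtain ⟨z, w⟩ := q
  have vert : ∀ {x y : ℤ}, (x, y) ∈ chainEnds h n → (x, y + 1) ∈ chainEnds h n →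
      GridJoined (chainEnds h (n + 1)) (2 * x + (h (n + 1)).1, 2 * y + (h (n + 1)).2)
        (2 * x + (h (n + 1)).1, 2 * (y + 1) + (h (n + 1)).2) := fun hp hq =>
    isGridSymmetry_swap.joined_of_map (joined_step_horizontal (isGridSymmetry_swap.headings H)
      (isGridSymmetry_swap.mem_chainEnds hp) (isGridSymmetry_swap.mem_chainEnds hq))
  simp only [gridGraph_adj_iff] at hpq
  have : (z = x + 1 ∧ w = y) ∨ (x = z + 1 ∧ w = y) ∨ (z = x ∧ w = y + 1) ∨ (z = x ∧ y = w + 1) := by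
    omega
  rcases this with ⟨rfl, rfl⟩ | ⟨rfl, rfl⟩ | ⟨rfl, rfl⟩ | ⟨rfl, rfl⟩
  · exact joined_step_horizontal H hp hq
  · exact (joined_step_horizontal H hq hp).symm
  · exact vert hp hq
  · exact (vert hq hp).symm

theorem gridConnected_chainEnds {h : ℕ → ℤ × ℤ} {n : ℕ} (H : Headings h n) :
    GridConnected (chainEnds h n) := by
  induction n with
  | zero =>
    refine gridConnected_of_joined (chainEnds_zero H) ?_
    have u := H.1 0 le_rfl
    have ray : ∀ k : ℕ, ∀ p : ℤ × ℤ, Ahead (h 0) 0 p → p.1.natAbs + p.2.natAbs = k + 1 →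
        p ∈ chainEnds h 0 ∧ GridJoined (chainEnds h 0) p (h 0) := by
      intro k
      induction k with
      | zero =>
        intro p ha hk
        have : p = h 0 := by
          simp only [IsUnitStep, Ahead, Prod.fst_zero, Prod.snd_zero] at *
          ext <;> omega
        rw [this]
        exact ⟨chainEnds_zero H, .refl⟩
      | succ k ih =>
        intro p ha hk
        have := ih (p.1 - (h 0).1, p.2 - (h 0).2)
          (by simp only [IsUnitStep, Ahead, Prod.fst_zero, Prod.snd_zero] at *; omega)
          (by simp only [IsUnitStep, Ahead, Prod.fst_zero, Prod.snd_zero] at *; omega)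
        have hp : p ∈ chainEnds h 0 := by
          refine ⟨fun i => if i = 0 then 0 else p, .of_disjoint H (by simp) (fun i hi => ?_)
            fun i j hij hj => by omega, by simp⟩
          obtain rfl : i = 0 := by omega
          simpa using ha
        refine ⟨hp, GridJoined.trans (.of_adj hp this.1 ?_) this.2⟩
        simp only [gridGraph_adj_iff, IsUnitStep] at *
        omega
    rintro p ⟨v, C, rfl⟩
    have a := C.ahead 0 le_rfl
    rw [C.zero] at a
    refine (ray ((v 1).1.natAbs + (v 1).2.natAbs - 1) _ a ?_).2
    simp only [IsUnitStep, Ahead, Prod.fst_zero, Prod.snd_zero, zero_add] at *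
    omega
  | succ n ih =>
    have hc := ih (H.mono (Nat.le_succ n))
    obtain ⟨o, ho⟩ := chainEnds_nonempty (H.mono (Nat.le_succ n))
    refine gridConnected_of_joined (chainEnds_append_unit H ho) fun p hp => ?_
    obtain ⟨q, hq, hj⟩ := joined_append_unit H hp
    refine hj.trans ?_
    have hqo := hc.joined hq ho
    clear hj hq
    induction hqo with
    | refl => exact .refl
    | tail _ hs ih => exact (ih hs.1).trans (joined_step H hs.1 hs.2.1 hs.2.2)

/-! ### Connectedness of the unreachable set -/

theorem gridConnected_compl_chainEnds {h : ℕ → ℤ × ℤ} {n : ℕ} (H : Headings h n)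
    (h0 : h 0 = (1, 0)) : GridConnected (chainEnds h n)ᶜ := by
  refine gridConnected_of_joined (zero_notMem_chainEnds H) ?_
  have key : ∀ k : ℕ, ∀ x y : ℤ, x.natAbs + y.natAbs = k → (x, y) ∈ (chainEnds h n)ᶜ →
      GridJoined (chainEnds h n)ᶜ (x, y) 0 := by
    intro k
    induction k with
    | zero =>
      intro x y hk hp
      obtain rfl : x = 0 := by omega
      obtain rfl : y = 0 := by omega
      exact .refl
    | succ k ih =>
      intro x y hk hp
      -- It is enough to find an unreachable neighbour nearer to the origin: were it reachable, an
      -- outward move would reach (x, y).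
      suffices ∃ x' y' : ℤ, x'.natAbs + y'.natAbs = k ∧ (x', y') ∈ (chainEnds h n)ᶜ ∧
          gridGraph.Adj (x, y) (x', y') by
        obtain ⟨x', y', hk', hp', ha⟩ := this
        exact GridJoined.trans (.of_adj hp hp' ha) (ih x' y' hk' hp')
      simp only [gridGraph_adj_iff]
      by_cases c1 : 2 ≤ x
      · refine ⟨x - 1, y, by omega, fun hm => hp ?_, by omega⟩
        simpa using chainEnds_expand H hm (by omega)
      by_cases c2 : x ≤ -2
      · refine ⟨x + 1, y, by omega, fun hm => hp ?_, by omega⟩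
        simpa using chainEnds_expand_left H hm (by omega)
      by_cases c3 : 2 ≤ y
      · refine ⟨x, y - 1, by omega, fun hm => hp ?_, by omega⟩
        simpa using chainEnds_expand_up H hm (by omega)
      by_cases c4 : y ≤ -2
      · refine ⟨x, y + 1, by omega, fun hm => hp ?_, by omega⟩
        simpa using chainEnds_expand_down H hm (by omega)
      by_cases c5 : x = 0
      · subst c5
        exact ⟨0, 0, by omega, zero_notMem_chainEnds H, by omega⟩
      by_cases c6 : y = 0
      · subst c6
        exact ⟨0, 0, by omega, zero_notMem_chainEnds H, by omega⟩
      -- Only the four points (±1, ±1) remain. With no turn, the initial heading east keeps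
      -- endpoints off the vertical axis.
      refine ⟨0, y, by omega, fun hm => hp ?_, by omega⟩
      rcases Nat.eq_zero_or_pos n with rfl | hn
      · obtain ⟨v, C, e⟩ := hm
        have a := C.ahead 0 le_rfl
        rw [e, h0, C.zero] at a
        simp only [Ahead, Prod.fst_zero] at a
        omega
      · have : x = 1 ∨ x = -1 := by omega
        rcases this with rfl | rfl
        · exact chainEnds_off_axis H hn c6 hm
        · exact chainEnds_off_axis_left H hn c6 hm
  rintro ⟨x, y⟩ hp
  exact key _ x y rfl hp

/-! ### From turn sequences and lengths to headings and vertices -/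

theorem heading_zero (σ : List Turn) : heading σ 0 = (1, 0) := by
  simp [heading]

theorem heading_succ (σ : List Turn) {i : ℕ} (hi : i < σ.length) :
    heading σ (i + 1) = (σ[i]).apply (heading σ i) := by
  rw [heading, heading, List.take_add_one, List.getElem?_eq_getElem hi, List.foldl_append]
  rfl

theorem headings_heading (σ : List Turn) : Headings (heading σ) σ.length := by
  have hu : ∀ i ≤ σ.length, IsUnitStep (heading σ i) := by
    intro i
    induction i with
    | zero => simp [heading_zero, IsUnitStep]
    | succ i ih =>
      intro hi
      have := ih (by omega)
      rw [heading_succ σ (by omega)]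
      cases σ[i] <;> simp only [IsUnitStep, Turn.apply] at * <;> omega
  refine ⟨hu, fun i hi => ?_⟩
  have := hu i hi.le
  rw [heading_succ σ hi]
  cases σ[i] <;> simp only [IsUnitStep, Turn.apply] at * <;> omega

theorem IsUnitStep.ahead {d : ℤ × ℤ} (hd : IsUnitStep d) (a : ℤ × ℤ) {l : ℕ} (hl : 0 < l) :
    Ahead d a (a + l • d) := by
  obtain ⟨x, y⟩ := d
  simp only [IsUnitStep] at hd
  have : (x = 1 ∧ y = 0) ∨ (x = -1 ∧ y = 0) ∨ (x = 0 ∧ y = 1) ∨ (x = 0 ∧ y = -1) := by omega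
  rcases this with ⟨rfl, rfl⟩ | ⟨rfl, rfl⟩ | ⟨rfl, rfl⟩ | ⟨rfl, rfl⟩ <;>
    simp [Ahead, hl]

theorem Ahead.eq_add {d a b : ℤ × ℤ} (hd : IsUnitStep d) (h : Ahead d a b) :
    0 < (b.1 - a.1).natAbs + (b.2 - a.2).natAbs ∧
      b = a + ((b.1 - a.1).natAbs + (b.2 - a.2).natAbs) • d := by
  obtain ⟨x, y⟩ := d
  simp only [IsUnitStep] at hd
  have : (x = 1 ∧ y = 0) ∨ (x = -1 ∧ y = 0) ∨ (x = 0 ∧ y = 1) ∨ (x = 0 ∧ y = -1) := by omega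
  rcases this with ⟨rfl, rfl⟩ | ⟨rfl, rfl⟩ | ⟨rfl, rfl⟩ | ⟨rfl, rfl⟩ <;>
    simp only [Ahead] at h <;> refine ⟨by omega, ?_⟩ <;> ext <;> simp [-Nat.cast_natAbs] <;> omega

theorem reachableSet_eq_chainEnds (σ : List Turn) :
    reachableSet σ = chainEnds (heading σ) σ.length := by
  have H := headings_heading σ
  ext p
  constructor
  · rintro ⟨l, ⟨hpos, hs⟩, rfl⟩
    refine ⟨chainVertex σ l, ⟨by simp [chainVertex], fun i hi => ?_, hs⟩, rfl⟩
    have : chainVertex σ l (i + 1) = chainVertex σ l i + l i • heading σ i :=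
      Finset.sum_range_succ _ _
    rw [this]
    exact (H.1 i hi).ahead _ (hpos i hi)
  · rintro ⟨v, C, rfl⟩
    let l : ℕ → ℕ := fun i =>
      ((v (i + 1)).1 - (v i).1).natAbs + ((v (i + 1)).2 - (v i).2).natAbs
    have hv : ∀ i ≤ σ.length + 1, chainVertex σ l i = v i := by
      intro i
      induction i with
      | zero => simp [chainVertex, C.zero]
      | succ i ih =>
        intro hi
        have : chainVertex σ l (i + 1) = chainVertex σ l i + l i • heading σ i :=
          Finset.sum_range_succ _ _
        rw [this, ih (by omega)]
        exact ((C.ahead i (by omega)).eq_add (H.1 i (by omega))).2.symm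
    refine ⟨l, ⟨fun i hi => ((C.ahead i hi).eq_add (H.1 i hi)).1, fun i j hij hj q => ?_⟩,
      hv _ le_rfl⟩
    rw [chainSegment, chainSegment, hv i (by omega), hv (i + 1) (by omega), hv j (by omega),
      hv (j + 1) (by omega)]
    exact C.simple i j hij hj q

theorem theorem2 (σ : List Turn) :
    GridConnected (reachableSet σ) ∧ GridConnected (reachableSet σ)ᶜ := by
  rw [reachableSet_eq_chainEnds]
  exact ⟨gridConnected_chainEnds (headings_heading σ),
    gridConnected_compl_chainEnds (headings_heading σ) (heading_zero σ)⟩
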